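/- **Theorem (The number of walks).** Consider lattice walks that start from $(0,0)$, consist of North-East, West and South steps $(1,1)$, $(-1,0)$, $(0,-1)$, and always stay in the first quadrant $\{(i,j): i,j\ge 0\}$ (Kreweras' walks). Let $a_{i,j}(n)$ be the number of such walks that have $n$ steps and end at $(i,j)$, and let $$Q(x,y;t)=\sum_{i,j,n\ge 0}a_{i,j}(n)\,x^iy^jt^n .$$ There is a unique power series $W\equiv W(t)\in\mathbb{Q}[[t]]$ such that $$W=t(2+W^3).$$ Let $\sqrt{1-xW^2}$ be the unique power series in $\mathbb{Q}[x][[t]]$ whose square is $1-xW^2$ and whose constant term in $t$ is $1$. Then the generating function of the walks ending on the $x$-axis is given, in the field $\mathbb{Q}(x)((t))$, by $$Q(x,0;t)=\frac 1{tx}\left(\frac 1{2t}-\frac 1x-\left(\frac 1W-\frac 1x\right)\sqrt{1-xW^2}\right).$$ Consequently, for every $i\ge 0$, the length generating function of the walks ending at $(i,0)$ is $$[x^i]\,Q(x,0;t)=\frac{W^{2i+1}}{2\cdot 4^i\,t}\left(C_i-\frac{C_{i+1}W^3}{4}\right),$$ where $C_i=\binom{2i}{i}/(i+1)$ is the $i$-th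 Catalan number, and for all $i,n\ge 0$ the number of such walks of length $3n+2i$ is $$a_{i,0}(3n+2i)=\frac{4^n(2i+1)}{(n+i+1)(2n+2i+1)}\binom{2i}{i}\binom{3n+2i}{n}.$$ -/

import Mathlib

namespace Kreweras

/-- The three allowed steps: North-East, West and South. -/
def steps : Finset (ℤ × ℤ) := {(1, 1), (-1, 0), (0, -1)}

/-- The position, after the first `k` steps, of the walk that starts from `(0,0)` and has the
step sequence `s`. -/
def position {n : ℕ} (s : Fin n → ℤ × ℤ) (k : ℕ) : ℤ × ℤ :=
  ∑ l : Fin n with l.val < k, s l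

/-- The `n`-step walks (as sequences of allowed steps) that start from `(0,0)`, stay in the first
quadrant at all times, and end at `(i, j)`. -/
def walks (i j n : ℕ) : Finset (Fin n → ℤ × ℤ) :=
  (Fintype.piFinset fun _ : Fin n => steps).filter fun s =>
    (∀ k ≤ n, 0 ≤ (position s k).1 ∧ 0 ≤ (position s k).2) ∧
      position s n = ((i : ℤ), (j : ℤ))

/-- `a_{i,j}(n)`: the number of `n`-step quadrant walks that end at `(i, j)`. -/
def numWalks (i j n : ℕ) : ℕ := (walks i j n).card

/-- An `n`-step walk cannot leave the square `[0, n] × [0, n]`. -/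
theorem numWalks_eq_zero {i j n : ℕ} (h : n < i ∨ n < j) : numWalks i j n = 0 := by
  rw [numWalks, Finset.card_eq_zero, Finset.eq_empty_iff_forall_notMem]
  intro s hs
  simp only [walks, Finset.mem_filter, Fintype.mem_piFinset] at hs
  obtain ⟨hst, -, hend⟩ := hs
  have hle : ∀ l, (s l).1 ≤ 1 ∧ (s l).2 ≤ 1 := by
    intro l
    have := hst l
    simp only [steps, Finset.mem_insert, Finset.mem_singleton] at this
    rcases this with h | h | h <;> simp [h]
  have hpos : position s n = ∑ l, s l := by
    simp [position]
  rw [hpos] at hend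
  have h1 : (∑ l, (s l).1) = (i : ℤ) := by
    have := congrArg Prod.fst hend
    simpa [Prod.fst_sum] using this
  have h2 : (∑ l, (s l).2) = (j : ℤ) := by
    have := congrArg Prod.snd hend
    simpa [Prod.snd_sum] using this
  have b1 : (∑ l, (s l).1) ≤ ∑ _l : Fin n, (1 : ℤ) := Finset.sum_le_sum fun l _ => (hle l).1
  have b2 : (∑ l, (s l).2) ≤ ∑ _l : Fin n, (1 : ℤ) := Finset.sum_le_sum fun l _ => (hle l).2
  simp at b1 b2
  omega

/-- The complete generating function `Q(x,y;t) = ∑ a_{i,j}(n) x^i y^j t^n`, as a power series in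
`t` with coefficients in `ℚ[x][y]` (inner variable `x`, outer variable `y`). The coefficient of
`t^n` is a finite sum since `a_{i,j}(n) = 0` as soon as `i > n` or `j > n`; see `coeff_Q`. -/
noncomputable def Q : PowerSeries (Polynomial (Polynomial ℚ)) :=
  PowerSeries.mk fun n =>
    ∑ j ∈ Finset.range (n + 1), ∑ i ∈ Finset.range (n + 1),
      Polynomial.monomial j (Polynomial.monomial i (numWalks i j n : ℚ))

/-- For all `i, j, n`, the coefficient of `x^i y^j t^n` in `Q` is `a_{i,j}(n)`. -/
theorem coeff_Q (i j n : ℕ) :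
    ((PowerSeries.coeff n Q).coeff j).coeff i = (numWalks i j n : ℚ) := by
  have h : (if j < n + 1 then if i < n + 1 then (numWalks i j n : ℚ) else 0 else 0) =
      (numWalks i j n : ℚ) := by
    split_ifs with h1 h2
    · rfl
    · rw [numWalks_eq_zero (Or.inl (by omega)), Nat.cast_zero]
    · rw [numWalks_eq_zero (Or.inr (by omega)), Nat.cast_zero]
  rw [← h]
  simp only [Q, PowerSeries.coeff_mk, Polynomial.finsetSum_coeff, Polynomial.coeff_monomial,
    apply_ite (fun p : Polynomial ℚ => p.coeff i), Polynomial.coeff_zero]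
  have e : ∀ j' i' : ℕ, (if j' = j then if i' = i then (numWalks i' j' n : ℚ) else 0 else 0) =
      if i' = i then if j' = j then (numWalks i j n : ℚ) else 0 else 0 := by
    intro j' i'
    split_ifs <;> simp_all
  simp [e, Finset.sum_ite_eq', Finset.mem_range]
  split_ifs <;> rfl

/-- `Q(x,0;t)`, a power series in `t` with coefficients in `ℚ[x]`. -/
noncomputable def Qx0 : PowerSeries (Polynomial ℚ) :=
  PowerSeries.map (Polynomial.evalRingHom (0 : Polynomial ℚ)) Q

/-- `[x^i] F(x;t)`, a power series in `t`. -/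
noncomputable def coeffX (i : ℕ) (F : PowerSeries (Polynomial ℚ)) : PowerSeries ℚ :=
  PowerSeries.mk fun n => (PowerSeries.coeff n F).coeff i

/-- The variable `t` in `K((t))`. -/
noncomputable def t (K : Type) [Field K] : LaurentSeries K := HahnSeries.single 1 1

/-- The variable `x` in `ℚ(x)((t))`. -/
noncomputable def x : LaurentSeries (RatFunc ℚ) := HahnSeries.C RatFunc.X

/-- The inclusion `R[[t]] → K((t))` induced by the canonical map `R → K`. -/
noncomputable def toLaurent {R : Type} [CommRing R] (K : Type) [Field K] [Algebra R K] :
    PowerSeries R →+* LaurentSeries K :=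
  (HahnSeries.ofPowerSeries ℤ K).comp (PowerSeries.map (algebraMap R K))

end Kreweras

/-! The proof is a guess-and-check version of the kernel method. Removing the last step of a walk
gives a functional equation for Q(x,y); the step set is symmetric, so Q(0,y) = Q(y,0) and the only
boundary unknown is the series Q(x,0). The kernel xy - t(x + y + x²y²) has a root Y = t + O(t²) in
ℚ(x)[[t]]. Substituting y = Y eliminates Q(x,y) and leaves t(x Q(x,0) + Y Q(Y,0)) = xY
(`Qx0_kernel`).

This single equation determines Q(x,0): the difference D of two solutions satisfies x D(x) + Y D(Y)
= 0, and since t divides Y the lowest coefficient of D must vanish (`eq_zero_of_kernel`). So it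
suffices to check the closed form (`kernel_identity`). As 1/t = 1/x + 1/Y + xY, this means that (1/W
- 1/z)√(1 - zW²) takes opposite values at z = x and z = Y. The difference of the squares is (1/x -
1/Y)(1/x + 1/Y + xY - (2 + W³)/W), which is zero because (2 + W³)/W = 1/t; constant terms in t
decide the sign.

The square root is expressed through the Catalan series c by √(1 - 4z) = 1 - 2z c(z) at z = xW²/4.
This avoids division in the check and makes the coefficients in x explicit; the coefficients of
powers of W (`coeff_W_pow`) then give the number of walks. -/

namespace Kreweras

/-! ### Substitution in power series and fixed-point equations -/

open PowerSeries Finset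

/-- The diagonal substitution `s = t` in `R[[t]][[s]]`. -/
noncomputable def diag {R : Type*} [CommRing R] : PowerSeries (PowerSeries R) →+* PowerSeries R where
  toFun G := mk fun m => ∑ p ∈ antidiagonal m, coeff p.2 (coeff p.1 G)
  map_zero' := by ext m; simp
  map_add' G H := by ext m; simp [sum_add_distrib]
  map_one' := by
    ext m
    rw [coeff_mk, sum_eq_single (0, m)]
    · simp
    · rintro ⟨a, b⟩ h hne
      rw [coeff_one, if_neg, map_zero]
      rintro rfl
      simp at h
      simp [h] at hne
    · simp
  map_mul' G H := by
    ext m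
    simp only [coeff_mk, coeff_mul, map_sum, sum_mul_sum]
    simp only [← sum_product', sum_sigma']
    -- Both sides sum over 2 × 2 arrays of naturals of total m, grouped by rows or by columns; the
    -- bijection is transposition, its own inverse.
    refine sum_nbij'
      (fun z => ⟨(z.2.1.1 + z.2.2.1, z.2.1.2 + z.2.2.2), (z.2.1.1, z.2.2.1), (z.2.1.2, z.2.2.2)⟩)
      (fun z => ⟨(z.2.1.1 + z.2.2.1, z.2.1.2 + z.2.2.2), (z.2.1.1, z.2.2.1), (z.2.1.2, z.2.2.2)⟩)
      ?_ ?_ ?_ ?_ ?_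
    all_goals
      rintro ⟨⟨i, j⟩, ⟨a, b⟩, ⟨c, d⟩⟩ h
      simp only [mem_sigma, mem_product, HasAntidiagonal.mem_antidiagonal] at h ⊢
    · exact ⟨by omega, by simp⟩
    · exact ⟨by omega, by simp⟩
    · obtain ⟨_, rfl, rfl⟩ := h; rfl
    · obtain ⟨_, rfl, rfl⟩ := h; rfl

theorem coeff_diag {R : Type*} [CommRing R] (G : PowerSeries (PowerSeries R)) (m : ℕ) :
    coeff m (diag G) = ∑ p ∈ antidiagonal m, coeff p.2 (coeff p.1 G) := by
  simp [diag]

theorem diag_C {R : Type*} [CommRing R] (F : PowerSeries R) : diag (C F) = F := by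
  ext m
  rw [coeff_diag, sum_eq_single (0, m)]
  · simp
  · rintro ⟨a, b⟩ h hne
    rw [coeff_C, if_neg, map_zero]
    rintro rfl
    simp at h
    simp [h] at hne
  · simp

theorem diag_map_C {R : Type*} [CommRing R] (F : PowerSeries R) :
    diag (PowerSeries.map C F) = F := by
  ext m
  rw [coeff_diag, sum_eq_single (m, 0)]
  · simp
  · rintro ⟨a, b⟩ h hne
    rw [coeff_map, coeff_C, if_neg]
    rintro rfl
    simp at h
    simp [h] at hne
  · simp

/-- For `f : R →+* S[[t]]`, the map `∑ rₙ tⁿ ↦ ∑ f(rₙ) tⁿ`. -/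
noncomputable def ev {R S : Type*} [CommRing R] [CommRing S] (f : R →+* PowerSeries S) :
    PowerSeries R →+* PowerSeries S :=
  diag.comp (PowerSeries.map f)

section ev
variable {R S T : Type*} [CommRing R] [CommRing S] [CommRing T] (f : R →+* PowerSeries S)

theorem ev_C (r : R) : ev f (C r) = f r := by
  simp [ev, diag_C]

theorem ev_X : ev f X = X := by
  have := diag_map_C (X : PowerSeries S)
  simpa [ev] using this

theorem ev_map (g : T →+* R) (F : PowerSeries T) :
    ev f (PowerSeries.map g F) = ev (f.comp g) F := by
  simp [ev, PowerSeries.map_comp]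

/-- Evaluation acts coefficientwise on series free of the substituted variable; in particular
substituting Y for x leaves W alone. -/
theorem ev_C_comp (g : R →+* S) (F : PowerSeries R) :
    ev (C.comp g) F = PowerSeries.map g F := by
  rw [← ev_map, ev, RingHom.comp_apply, diag_map_C]

end ev

theorem eq_zero_of_forall_X_pow_dvd {R : Type*} [CommRing R] {F : PowerSeries R}
    (h : ∀ n, (X : PowerSeries R) ^ n ∣ F) : F = 0 := by
  ext n
  exact X_pow_dvd_iff.1 (h (n + 1)) n n.lt_succ_self

/-- The map Y ↦ t p(Y) is a t-adic contraction: A - B divides p(A) - p(B), and the factor t gains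
one order. -/
theorem X_pow_dvd_sub_of_fixed {R : Type*} [CommRing R] (p : Polynomial (PowerSeries R))
    {A B A' B' : PowerSeries R} (hA : A' = X * p.eval A) (hB : B' = X * p.eval B) {n : ℕ}
    (h : (X : PowerSeries R) ^ n ∣ A - B) : (X : PowerSeries R) ^ (n + 1) ∣ A' - B' := by
  rw [hA, hB, ← mul_sub, pow_succ']
  exact mul_dvd_mul_left _ (h.trans (Polynomial.sub_dvd_eval_sub _ _ _))

/-- The equation `Y = t p(Y)` has a unique power series solution. -/
theorem existsUnique_eq_X_mul_eval {R : Type*} [CommRing R] (p : Polynomial (PowerSeries R)) :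
    ∃! Y : PowerSeries R, Y = X * p.eval Y := by
  have unique : ∀ A B : PowerSeries R, A = X * p.eval A → B = X * p.eval B → A = B := by
    intro A B hA hB
    refine sub_eq_zero.1 (eq_zero_of_forall_X_pow_dvd fun n => ?_)
    induction n with
    | zero => simp
    | succ n ih => exact X_pow_dvd_sub_of_fixed p hA hB ih
  let u : ℕ → PowerSeries R := fun n => (fun Y => X * p.eval Y)^[n] 0
  have hu : ∀ n, u (n + 1) = X * p.eval (u n) := fun n => Function.iterate_succ_apply' _ _ _
  have hstep : ∀ n, (X : PowerSeries R) ^ n ∣ u (n + 1) - u n := by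
    intro n
    induction n with
    | zero => simp
    | succ n ih => exact X_pow_dvd_sub_of_fixed p (hu _) (hu _) ih
  have hdiff : ∀ n k, (X : PowerSeries R) ^ n ∣ u (n + k) - u n := by
    intro n k
    induction k with
    | zero => simp
    | succ k ih =>
      have := dvd_add ((pow_dvd_pow _ (Nat.le_add_right n k)).trans (hstep (n + k))) ih
      rwa [sub_add_sub_cancel] at this
  -- The limit of the iterates: the coefficient of t^n no longer changes from `u (n + 1)` on.
  let Y : PowerSeries R := mk fun n => coeff n (u (n + 1))
  have hY : ∀ n, (X : PowerSeries R) ^ n ∣ Y - u n := by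
    intro n
    rw [X_pow_dvd_iff]
    intro m hm
    obtain ⟨k, rfl⟩ := Nat.exists_eq_add_of_lt hm
    have := X_pow_dvd_iff.1 (hdiff (m + 1) k) m m.lt_succ_self
    rw [map_sub, sub_eq_zero] at this
    rw [map_sub, coeff_mk, ← this, add_right_comm, sub_self]
  have hfix : Y = X * p.eval Y := by
    refine sub_eq_zero.1 (eq_zero_of_forall_X_pow_dvd fun n => ?_)
    have h1 := X_pow_dvd_sub_of_fixed p (hu n) rfl (dvd_sub_comm.1 (hY n))
    have := (pow_dvd_pow _ n.le_succ).trans (dvd_add (hY (n + 1)) h1)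
    rwa [sub_add_sub_cancel] at this
  exact ⟨Y, hfix, fun B hB => unique B Y hB hfix⟩

/-- A square root is determined by its constant term `1`. -/
theorem eq_of_sq_eq_sq_of_constantCoeff {R : Type*} [CommRing R] [IsDomain R] [CharZero R]
    {A B : PowerSeries R} (hA : constantCoeff A = 1) (hB : constantCoeff B = 1)
    (h : A ^ 2 = B ^ 2) : A = B := by
  rcases sq_eq_sq_iff_eq_or_eq_neg.1 h with h | h
  · exact h
  · have := congrArg constantCoeff h
    rw [map_neg, hA, hB] at this
    norm_num [eq_neg_iff_add_eq_zero] at this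

end Kreweras

/-! ### Last-step recurrence and functional equation -/

namespace Kreweras

/-- The `n`-step quadrant walks ending at an arbitrary point `p`. -/
def walksTo (p : ℤ × ℤ) (n : ℕ) : Finset (Fin n → ℤ × ℤ) :=
  (Fintype.piFinset fun _ : Fin n => steps).filter fun s =>
    (∀ k ≤ n, 0 ≤ (position s k).1 ∧ 0 ≤ (position s k).2) ∧ position s n = p

theorem numWalks_eq_card_walksTo (i j n : ℕ) :
    numWalks i j n = (walksTo ((i : ℤ), (j : ℤ)) n).card := rfl

theorem position_snoc_of_le {n : ℕ} (s : Fin n → ℤ × ℤ) (d : ℤ × ℤ) {k : ℕ} (hk : k ≤ n) :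
    position (Fin.snoc s d : Fin (n + 1) → ℤ × ℤ) k = position s k := by
  simp [position, Finset.sum_filter, Fin.sum_univ_castSucc, Nat.not_lt.2 hk]

theorem position_snoc_last {n : ℕ} (s : Fin n → ℤ × ℤ) (d : ℤ × ℤ) :
    position (Fin.snoc s d : Fin (n + 1) → ℤ × ℤ) (n + 1) = position s n + d := by
  simp [position, Finset.sum_filter, Fin.sum_univ_castSucc]

/-- Appending a step leaves earlier positions unchanged, so the only new quadrant condition is on
the endpoint. -/
theorem snoc_mem_walksTo {p : ℤ × ℤ} {n : ℕ} (s : Fin n → ℤ × ℤ) (d : ℤ × ℤ) :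
    (Fin.snoc s d : Fin (n + 1) → ℤ × ℤ) ∈ walksTo p (n + 1) ↔
      (0 ≤ p.1 ∧ 0 ≤ p.2) ∧ d ∈ steps ∧ s ∈ walksTo (p - d) n := by
  simp only [walksTo, Finset.mem_filter, Fintype.mem_piFinset, Fin.forall_fin_succ',
    Fin.snoc_castSucc, Fin.snoc_last, position_snoc_last, eq_sub_iff_add_eq]
  constructor
  · rintro ⟨⟨hs, hd⟩, hq, rfl⟩
    refine ⟨?_, hd, hs, fun k hk => ?_, rfl⟩
    · have := hq (n + 1) le_rfl
      rwa [position_snoc_last] at this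
    · have := hq k (hk.trans n.le_succ)
      rwa [position_snoc_of_le s d hk] at this
  · rintro ⟨hp, hd, hs, hq, rfl⟩
    refine ⟨⟨hs, hd⟩, fun k hk => ?_, rfl⟩
    rcases hk.lt_or_eq with hk | rfl
    · rw [position_snoc_of_le s d (Nat.lt_succ_iff.1 hk)]
      exact hq k (Nat.lt_succ_iff.1 hk)
    · rwa [position_snoc_last]

theorem card_walksTo_succ {p : ℤ × ℤ} (hp : 0 ≤ p.1 ∧ 0 ≤ p.2) (n : ℕ) :
    (walksTo p (n + 1)).card = ∑ d ∈ steps, (walksTo (p - d) n).card := by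
  rw [← Finset.card_sigma]
  symm
  refine Finset.card_bij (fun z _ => (Fin.snoc z.2 z.1 : Fin (n + 1) → ℤ × ℤ)) ?_ ?_ ?_
  · rintro ⟨d, s⟩ h
    exact (snoc_mem_walksTo s d).2 ⟨hp, Finset.mem_sigma.1 h⟩
  · rintro ⟨d, s⟩ _ ⟨d', s'⟩ _ h
    obtain ⟨rfl, rfl⟩ := Fin.snoc_injective2 h
    rfl
  · intro w hw
    rw [← Fin.snoc_init_self w, snoc_mem_walksTo] at hw
    exact ⟨⟨_, _⟩, Finset.mem_sigma.2 hw.2, Fin.snoc_init_self w⟩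

theorem walksTo_eq_empty {p : ℤ × ℤ} (hp : p.1 < 0 ∨ p.2 < 0) (n : ℕ) : walksTo p n = ∅ := by
  rw [walksTo, Finset.filter_eq_empty_iff]
  rintro s - ⟨h, rfl⟩
  have := h n le_rfl
  omega

theorem numWalks_zero (i j : ℕ) : numWalks i j 0 = if i = 0 ∧ j = 0 then 1 else 0 := by
  split_ifs with h
  · obtain ⟨rfl, rfl⟩ := h
    rw [numWalks, Finset.card_eq_one]
    refine ⟨Fin.elim0, ?_⟩
    ext s
    simp [walks, position, Subsingleton.elim s Fin.elim0, Prod.zero_eq_mk.symm]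
    exact Subsingleton.elim _ _
  · exact numWalks_eq_zero (by omega)

theorem numWalks_succ (i j n : ℕ) :
    numWalks i j (n + 1) = (if 1 ≤ i ∧ 1 ≤ j then numWalks (i - 1) (j - 1) n else 0) +
      numWalks (i + 1) j n + numWalks i (j + 1) n := by
  rw [numWalks_eq_card_walksTo, card_walksTo_succ (by simp)]
  simp only [steps]
  rw [Finset.sum_insert (by decide), Finset.sum_insert (by decide), Finset.sum_singleton, ← add_assoc]
  congr 1
  · congr 1
    · split_ifs with h
      · rw [numWalks_eq_card_walksTo]
        simp [Nat.cast_sub h.1, Nat.cast_sub h.2]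
      · rw [walksTo_eq_empty, Finset.card_empty]
        simp only [Prod.fst_sub, Prod.snd_sub]
        omega

/-- The recurrence is invariant under exchanging the axes. This replaces Q(0,y) by Q(y,0) in the
functional equation. -/
theorem numWalks_symm (i j n : ℕ) : numWalks i j n = numWalks j i n := by
  induction n generalizing i j with
  | zero => simp only [numWalks_zero, and_comm]
  | succ n ih =>
    rw [numWalks_succ, numWalks_succ, ih (i - 1), ih (i + 1), ih i, add_right_comm]
    simp only [and_comm]

theorem coeff_Qx0 (i n : ℕ) : (PowerSeries.coeff n Qx0).coeff i = (numWalks i 0 n : ℚ) := by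
  rw [← coeff_Q, Qx0, PowerSeries.coeff_map, Polynomial.coe_evalRingHom,
    Polynomial.coeff_zero_eq_eval_zero]

open Polynomial in
theorem coeff_Q_zero : PowerSeries.coeff 0 Q = 1 := by
  ext j i
  rw [coeff_Q, numWalks_zero, coeff_one]
  split_ifs <;> simp_all [coeff_one]

open Polynomial in
/-- The kernel equation for the coefficient of `t ^ (n + 1)`. -/
theorem coeff_Q_succ (n : ℕ) :
    (X : ℚ[X][X]) * (C X * PowerSeries.coeff (n + 1) Q) + C X * C (PowerSeries.coeff n Qx0) +
        X * (PowerSeries.coeff n Qx0).map C =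
      C X * PowerSeries.coeff n Q + X * PowerSeries.coeff n Q +
        X * (X * (C X * (C X * PowerSeries.coeff n Q))) := by
  ext j i
  -- On the axes, the terms in `Qx0` cancel the South and West contributions that would leave the
  -- quadrant.
  rcases j with _ | j
  · rcases i with _ | i
    · simp
    · simp [coeff_Q, coeff_Qx0]
  · rcases i with _ | i
    · rcases j with _ | j <;> simp [coeff_Q, coeff_Qx0, numWalks_symm 0]
    · rcases j with _ | j <;> rcases i with _ | i <;>
        simp [coeff_Q, coeff_Qx0, coeff_C_succ, numWalks_succ] <;> ring

open Polynomial in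
/-- The functional equation for the complete generating function. -/
theorem Q_functional_equation :
    PowerSeries.C (X * C X) * Q + PowerSeries.X *
        (PowerSeries.C (C X) * PowerSeries.map C Qx0 +
          PowerSeries.C X * PowerSeries.map (mapRingHom C) Qx0) =
      PowerSeries.C (X * C X) +
        PowerSeries.X * (PowerSeries.C (C X + X + X ^ 2 * C X ^ 2) * Q) := by
  ext1 n
  rcases n with _ | n
  · rw [map_add, map_add, PowerSeries.coeff_C_mul, coeff_Q_zero]
    simp
  · have h := coeff_Q_succ n
    rw [map_add, map_add, PowerSeries.coeff_succ_X_mul, PowerSeries.coeff_succ_X_mul, map_add]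
    simp only [PowerSeries.coeff_C_mul, PowerSeries.coeff_map, PowerSeries.coeff_succ_C, coe_mapRingHom]
    linear_combination h

end Kreweras

namespace Kreweras

/-! ### The Catalan series at xU and its coefficients in x -/

section CatalanRoot

open Polynomial

/-- The Catalan generating function evaluated at `x U`. -/
noncomputable def catalanRoot (U : PowerSeries ℚ) : PowerSeries ℚ[X] :=
  (PowerSeries.catalanSeries.map (Nat.castRingHom ℚ)).subst
    (PowerSeries.C X * PowerSeries.map C U)

variable {U : PowerSeries ℚ}

theorem hasSubst_catalanRoot (hU : PowerSeries.constantCoeff U = 0) :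
    PowerSeries.HasSubst (PowerSeries.C X * PowerSeries.map C U : PowerSeries ℚ[X]) := by
  apply PowerSeries.HasSubst.of_constantCoeff_zero'
  rw [map_mul, ← PowerSeries.coeff_zero_eq_constantCoeff_apply (PowerSeries.map C U),
    PowerSeries.coeff_map, PowerSeries.coeff_zero_eq_constantCoeff_apply, hU, map_zero, mul_zero]

theorem catalanRoot_eq (hU : PowerSeries.constantCoeff U = 0) :
    catalanRoot U = 1 + PowerSeries.C X * PowerSeries.map C U * catalanRoot U ^ 2 := by
  have hs := hasSubst_catalanRoot hU
  have h := congrArg (fun F => PowerSeries.substAlgHom hs (PowerSeries.map (Nat.castRingHom ℚ) F))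
    PowerSeries.catalanSeries_sq_mul_X_add_one
  simp only [map_add, map_mul, map_pow, map_one, PowerSeries.map_X,
    PowerSeries.substAlgHom_X, PowerSeries.coe_substAlgHom] at h
  rw [← catalanRoot] at h
  linear_combination -h

theorem coeffX_map_C_mul (i : ℕ) (A : PowerSeries ℚ) (F : PowerSeries ℚ[X]) :
    coeffX i (PowerSeries.map C A * F) = A * coeffX i F := by
  ext n
  simp [coeffX, PowerSeries.coeff_mul, finsetSum_coeff]

theorem coeffX_sub (i : ℕ) (F G : PowerSeries ℚ[X]) :
    coeffX i (F - G) = coeffX i F - coeffX i G := by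
  ext n
  simp [coeffX]

theorem coeffX_catalanRoot (hU : PowerSeries.constantCoeff U = 0) (i : ℕ) :
    coeffX i (catalanRoot U) = PowerSeries.C (catalan i : ℚ) * U ^ i := by
  have hs := hasSubst_catalanRoot hU
  have hpow : ∀ d n : ℕ,
      PowerSeries.coeff n ((PowerSeries.C X * PowerSeries.map C U : PowerSeries ℚ[X]) ^ d) =
        X ^ d * C (PowerSeries.coeff n (U ^ d)) := by
    intro d n
    rw [mul_pow, ← map_pow, ← map_pow, PowerSeries.coeff_C_mul, PowerSeries.coeff_map]
  ext n
  rw [coeffX, PowerSeries.coeff_mk, catalanRoot, PowerSeries.coeff_subst' hs,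
    ← lcoeff_apply, ← LinearMap.toAddMonoidHom_coe,
    AddMonoidHom.map_finsum _ (PowerSeries.coeff_subst_finite' hs _ _), finsum_eq_single _ i]
  · rw [PowerSeries.coeff_C_mul]
    simp [hpow]
  · intro d hd
    simp [hpow, coeff_X_pow, hd.symm]

/-- Compare coefficients of x^(i+1) in c = 1 + xUc² and cancel U. -/
theorem coeffX_catalanRoot_sq (hU : PowerSeries.constantCoeff U = 0) (hU0 : U ≠ 0) (i : ℕ) :
    coeffX i (catalanRoot U ^ 2) = PowerSeries.C (catalan (i + 1) : ℚ) * U ^ i := by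
  have h1 : coeffX (i + 1) (catalanRoot U) = U * coeffX i (catalanRoot U ^ 2) := by
    rw [← coeffX_map_C_mul]
    nth_rw 1 [catalanRoot_eq hU]
    rw [mul_assoc]
    ext n
    simp [coeffX, PowerSeries.coeff_one, apply_ite (fun p : ℚ[X] => p.coeff (i + 1)), coeff_one]
  apply mul_left_cancel₀ hU0
  rw [← h1, coeffX_catalanRoot hU]
  ring

end CatalanRoot

/-! ### Checking the candidate on the kernel, and uniqueness -/

section Kernel

open PowerSeries

variable {K : Type*} [Field K]

/-- The kernel identity satisfied by the candidate for `t x Q(x,0;t)`. -/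
theorem kernel_identity [CharZero K] {ξ : K} (hξ : ξ ≠ 0) {w y c₁ c₂ : PowerSeries K}
    (hw : w = X * (2 + w ^ 3))
    (hy : C ξ * y = C ξ + X * y + C ξ ^ 2 * (X * y) ^ 2)
    (h₁ : 4 * c₁ = 4 + C ξ * w ^ 2 * c₁ ^ 2)
    (h₂ : 4 * c₂ = 4 + (X * y) * w ^ 2 * c₂ ^ 2) :
    C ξ * (w * (4 * c₁ - w ^ 3 * c₁ ^ 2)) + X * y * (w * (4 * c₂ - w ^ 3 * c₂ ^ 2)) =
      8 * (C ξ * (X * y)) := by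
  set x : PowerSeries K := C ξ with hx
  set v : PowerSeries K := 2 + w ^ 3 with hv
  have hX : (X : PowerSeries K) ≠ 0 := X_ne_zero
  have hx0 : x ≠ 0 := by simpa [hx] using hξ
  have hw0 : constantCoeff w = 0 := by rw [hw]; simp
  have hv0 : constantCoeff v = 2 := by
    rw [hv, map_add, map_pow, hw0, map_ofNat]; simp
  have hy0 : constantCoeff y = 1 := by
    have := congrArg constantCoeff hy
    simp only [map_add, map_mul, map_pow, hx, constantCoeff_C, constantCoeff_X] at this
    exact mul_left_cancel₀ hξ (by linear_combination this)
  have hwne : w ≠ 0 := by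
    rw [hw]
    refine mul_ne_zero hX fun h => ?_
    rw [h, map_zero] at hv0
    norm_num at hv0
  have hyne : y ≠ 0 := by
    rintro rfl
    simp at hy0
  have hB : w * (x + X * y + x ^ 2 * (X * y) ^ 2) = x * (X * y) * v := by
    linear_combination (x + X * y + x ^ 2 * (X * y) ^ 2) * hw - X * v * hy
  have hs₁ : (2 - x * w ^ 2 * c₁) ^ 2 = 4 * (1 - x * w ^ 2) := by
    linear_combination (-x * w ^ 2) * h₁
  have hs₂ : (2 - X * y * w ^ 2 * c₂) ^ 2 = 4 * (1 - X * y * w ^ 2) := by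
    linear_combination (-(X * y) * w ^ 2) * h₂
  -- With Y = ty and w = tv, dividing the two bases by 2xyw gives (1/w - 1/z)√(1 - zw²) at z = x and
  -- z = Y.
  have hsq : (y * (x - w) * (2 - x * w ^ 2 * c₁)) ^ 2 =
      (x * (y - v) * (2 - X * y * w ^ 2 * c₂)) ^ 2 := by
    rw [mul_pow, mul_pow _ (2 - X * y * w ^ 2 * c₂), hs₁, hs₂]
    apply mul_left_cancel₀ (pow_ne_zero 2 hX)
    have e : X ^ 2 * (x * (y - v)) ^ 2 = (x * (X * y - w)) ^ 2 := by
      rw [hw]; ring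
    linear_combination 4 * (X * y - x) * w * hB + 4 * (X * y - x) * w * x * (X * y) * hv -
      4 * (1 - X * y * w ^ 2) * e
  rcases sq_eq_sq_iff_eq_or_eq_neg.1 hsq with h | h
  -- At t = 0 the two bases are 2ξ and -2ξ, which excludes equality.
  · exfalso
    have := congrArg constantCoeff h
    simp only [map_mul, map_sub, map_pow, hx, constantCoeff_C, constantCoeff_X, hw0, hv0, hy0,
      map_ofNat] at this
    exact hξ (by linear_combination this / 4)
  · apply mul_left_cancel₀ (mul_ne_zero (mul_ne_zero hwne hx0) hyne)
    linear_combination w ^ 3 * x * y * (h₁ + h₂) - 4 * h + 8 * v * hy +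
      (-4 * x * w ^ 2 * y * c₂ - 8 * y - 8 * X * x ^ 2 * y ^ 2) * hw - 8 * x * y * hv

/-- A series `D(x;t)` such that `x D(x) + Y D(Y) = 0` vanishes, when `Y = O(t)`. -/
theorem eq_zero_of_kernel {R : Type*} [CommRing R] [Algebra R K]
    (hinj : Function.Injective (algebraMap R K)) {ξ : K} (hξ : ξ ≠ 0)
    (f : R →+* PowerSeries K) (y : PowerSeries K) {D : PowerSeries R}
    (h : C ξ * PowerSeries.map (algebraMap R K) D + X * y * ev f D = 0) : D = 0 := by
  refine eq_zero_of_forall_X_pow_dvd fun n => ?_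
  induction n with
  | zero => simp
  | succ n ih =>
    obtain ⟨E, rfl⟩ := ih
    rw [pow_succ]
    refine mul_dvd_mul_left _ (X_dvd_iff.2 ?_)
    rw [map_mul, map_mul, map_pow, map_pow, ev_X, map_X] at h
    have h' : X ^ n * (C ξ * PowerSeries.map (algebraMap R K) E + X * y * ev f E) = 0 := by
      rw [← h]; ring
    -- At t = 0 the second term vanishes by its factor t, leaving ξ E(0) = 0.
    have h2 := congrArg constantCoeff ((mul_eq_zero.1 h').resolve_left (pow_ne_zero n X_ne_zero))
    simp [hξ] at h2
    exact (map_eq_zero_iff _ hinj).1 h2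

end Kernel

end Kreweras

/-! ### Identification of Q(x,0) with the closed form -/

namespace Kreweras

open Polynomial in
/-- The closed form of `Q(x,0;t)` in terms of `W` and the Catalan generating function. -/
noncomputable def Qx0Closed (W : PowerSeries ℚ) : PowerSeries ℚ[X] :=
  PowerSeries.map C (PowerSeries.C (1 / 8) * (2 + W ^ 3)) *
    (4 * catalanRoot (PowerSeries.C (1 / 4) * W ^ 2) -
      PowerSeries.map C (W ^ 3) * catalanRoot (PowerSeries.C (1 / 4) * W ^ 2) ^ 2)

variable {W : PowerSeries ℚ}

theorem constantCoeff_eq_zero_of_eq (hW : W = PowerSeries.X * (2 + W ^ 3)) :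
    PowerSeries.constantCoeff W = 0 := by
  rw [hW]; simp

theorem ne_zero_of_eq (hW : W = PowerSeries.X * (2 + W ^ 3)) : W ≠ 0 := by
  have := algebraRat.charZero (PowerSeries ℚ)
  rintro rfl
  simp at hW

theorem four_mul_catalanRoot (hW : PowerSeries.constantCoeff W = 0) :
    4 * catalanRoot (PowerSeries.C (1 / 4) * W ^ 2) = 4 +
      PowerSeries.C Polynomial.X * PowerSeries.map Polynomial.C W ^ 2 *
        catalanRoot (PowerSeries.C (1 / 4) * W ^ 2) ^ 2 := by
  have h4 : (4 : PowerSeries (Polynomial ℚ)) *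
      PowerSeries.map Polynomial.C (PowerSeries.C (1 / 4)) = 1 := by
    rw [← map_ofNat (PowerSeries.map (Polynomial.C (R := ℚ))) 4, ← map_mul,
      ← map_ofNat (PowerSeries.C (R := ℚ)) 4, ← map_mul]
    norm_num
  have h := catalanRoot_eq (U := PowerSeries.C (1 / 4) * W ^ 2) (by simp [hW])
  rw [map_mul (PowerSeries.map Polynomial.C), map_pow] at h
  linear_combination 4 * h + PowerSeries.C Polynomial.X * PowerSeries.map Polynomial.C W ^ 2 *
        catalanRoot (PowerSeries.C (1 / 4) * W ^ 2) ^ 2 * h4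

/-- The factor (2 + W³)/8 in `Qx0Closed` stands for W/(8t), written without division; multiplying by
8t restores W. -/
theorem X_mul_Qx0Closed (hW : W = PowerSeries.X * (2 + W ^ 3)) :
    8 * (PowerSeries.X * Qx0Closed W) = PowerSeries.map Polynomial.C W *
      (4 * catalanRoot (PowerSeries.C (1 / 4) * W ^ 2) - PowerSeries.map Polynomial.C W ^ 3 *
        catalanRoot (PowerSeries.C (1 / 4) * W ^ 2) ^ 2) := by
  have h8 : (8 : PowerSeries (Polynomial ℚ)) *
      PowerSeries.map Polynomial.C (PowerSeries.C (1 / 8)) = 1 := by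
    rw [← map_ofNat (PowerSeries.map (Polynomial.C (R := ℚ))) 8, ← map_mul,
      ← map_ofNat (PowerSeries.C (R := ℚ)) 8, ← map_mul]
    norm_num
  have h := congrArg (PowerSeries.map Polynomial.C) hW
  rw [map_mul, PowerSeries.map_X] at h
  rw [Qx0Closed, map_mul (PowerSeries.map Polynomial.C), map_pow]
  generalize PowerSeries.map Polynomial.C (2 + W ^ 3) = v at h ⊢
  generalize 4 * catalanRoot _ - _ = z
  linear_combination PowerSeries.X * v * z * h8 - z * h

/-- Divided by ξ, the kernel equation is the fixed-point equation Y = t(1 + Y/ξ + ξY²); the witness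
is y = Y/t. -/
theorem exists_kernel_root {K : Type*} [Field K] {ξ : K} (hξ : ξ ≠ 0) :
    ∃ y : PowerSeries K, PowerSeries.C ξ * y = PowerSeries.C ξ + PowerSeries.X * y +
      PowerSeries.C ξ ^ 2 * (PowerSeries.X * y) ^ 2 := by
  obtain ⟨Y, hY, -⟩ := existsUnique_eq_X_mul_eval (1 +
    Polynomial.C (PowerSeries.C ξ⁻¹) * Polynomial.X +
      Polynomial.C (PowerSeries.C ξ) * Polynomial.X ^ 2 : Polynomial (PowerSeries K))
  simp only [Polynomial.eval_add, Polynomial.eval_one, Polynomial.eval_mul, Polynomial.eval_C,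
    Polynomial.eval_X, Polynomial.eval_pow] at hY
  refine ⟨1 + PowerSeries.C ξ⁻¹ * Y + PowerSeries.C ξ * Y ^ 2, ?_⟩
  have h1 : PowerSeries.C ξ * PowerSeries.C ξ⁻¹ = 1 := by
    rw [← map_mul, mul_inv_cancel₀ hξ, map_one]
  rw [← hY]
  linear_combination Y * h1

open Polynomial in
theorem Qx0_kernel {K : Type*} [Field K] [Algebra ℚ[X] K] {y : PowerSeries K}
    (hy : PowerSeries.C (algebraMap ℚ[X] K X) * y = PowerSeries.C (algebraMap ℚ[X] K X) +
      PowerSeries.X * y + PowerSeries.C (algebraMap ℚ[X] K X) ^ 2 * (PowerSeries.X * y) ^ 2) :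
    PowerSeries.X * (PowerSeries.C (algebraMap ℚ[X] K X) *
        PowerSeries.map (algebraMap ℚ[X] K) Qx0 + PowerSeries.X * y *
      ev (eval₂RingHom (PowerSeries.C.comp ((algebraMap ℚ[X] K).comp C)) (PowerSeries.X * y)) Qx0) =
    PowerSeries.C (algebraMap ℚ[X] K X) * (PowerSeries.X * y) := by
  -- The substitution of Y = ty for the outer variable, with x fixed; `hy` then cancels every term
  -- in Q(x,Y).
  let g : ℚ[X][X] →+* PowerSeries K :=
    eval₂RingHom (PowerSeries.C.comp (algebraMap ℚ[X] K)) (PowerSeries.X * y)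
  have h := congrArg (ev g) Q_functional_equation
  have hg1 : g.comp C = PowerSeries.C.comp (algebraMap ℚ[X] K) := by
    ext <;> simp [g]
  have hg2 : g.comp (mapRingHom C) =
      eval₂RingHom (PowerSeries.C.comp ((algebraMap ℚ[X] K).comp C)) (PowerSeries.X * y) := by
    ext <;> simp [g]
  have hgC : g (C X) = PowerSeries.C (algebraMap ℚ[X] K X) := by simp [g]
  have hgX : g X = PowerSeries.X * y := by simp [g]
  simp only [map_add, map_mul, map_pow, ev_C, ev_X, ev_map, hg1, hg2, ev_C_comp, hgC, hgX] at h
  linear_combination h - PowerSeries.X * ev g Q * hy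

open Polynomial in
theorem Qx0_eq_Qx0Closed (hW : W = PowerSeries.X * (2 + W ^ 3)) : Qx0 = Qx0Closed W := by
  have hξ : algebraMap ℚ[X] (RatFunc ℚ) X ≠ 0 := by
    rw [RatFunc.algebraMap_X]
    exact RatFunc.X_ne_zero
  obtain ⟨y, hy⟩ := exists_kernel_root hξ
  let e := algebraMap ℚ[X] (RatFunc ℚ)
  let f : ℚ[X] →+* PowerSeries (RatFunc ℚ) :=
    eval₂RingHom (PowerSeries.C.comp (e.comp C)) (PowerSeries.X * y)
  have hfC : f.comp C = PowerSeries.C.comp (e.comp C) := by ext; simp [f]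
  have hfX : f X = PowerSeries.X * y := by simp [f]
  have heC : ∀ F, PowerSeries.map e (PowerSeries.map C F) = PowerSeries.map (e.comp C) F :=
    fun F => by simp [PowerSeries.map_comp]
  have hfe : ∀ F, ev f (PowerSeries.map C F) = PowerSeries.map (e.comp C) F :=
    fun F => by rw [ev_map, hfC, ev_C_comp]
  have hc := four_mul_catalanRoot (constantCoeff_eq_zero_of_eq hW)
  have hq := X_mul_Qx0Closed hW
  have hw := congrArg (PowerSeries.map (e.comp C)) hW
  have hc1 := congrArg (PowerSeries.map e) hc
  have hc2 := congrArg (ev f) hc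
  have hq1 := congrArg (PowerSeries.map e) hq
  have hq2 := congrArg (ev f) hq
  simp only [map_add, map_sub, map_mul, map_pow, map_ofNat, PowerSeries.map_X, PowerSeries.map_C,
    ev_C, ev_X, hfX, heC, hfe] at hw hc1 hc2 hq1 hq2
  have hk := kernel_identity hξ hw hy hc1 hc2
  have hQ := Qx0_kernel hy
  refine sub_eq_zero.1 (eq_zero_of_kernel (IsFractionRing.injective ℚ[X] (RatFunc ℚ)) hξ f y ?_)
  have := algebraRat.charZero (PowerSeries (RatFunc ℚ))
  have h8 : (8 * PowerSeries.X : PowerSeries (RatFunc ℚ)) ≠ 0 :=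
    mul_ne_zero (by norm_num) PowerSeries.X_ne_zero
  apply mul_left_cancel₀ h8
  rw [map_sub, map_sub]
  linear_combination 8 * hQ - hk - PowerSeries.C (e X) * hq1 - PowerSeries.X * y * hq2

end Kreweras

namespace Kreweras

/-! ### Coefficients of powers of W and the number of walks -/

section Coefficients

open PowerSeries

variable {W : PowerSeries ℚ}

theorem coeff_W_pow_of_lt (hW : W = X * (2 + W ^ 3)) {k m : ℕ} (h : m < k) :
    coeff m (W ^ k) = 0 :=
  X_pow_dvd_iff.1 (pow_dvd_pow_of_dvd (Dvd.intro _ hW.symm) k) m h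

theorem coeff_W_pow_self (hW : W = X * (2 + W ^ 3)) (k : ℕ) : coeff k (W ^ k) = 2 ^ k := by
  rw [hW, mul_pow, coeff_X_pow_mul', if_pos le_rfl, Nat.sub_self,
    coeff_zero_eq_constantCoeff_apply, map_pow, map_add, map_pow, constantCoeff_eq_zero_of_eq hW,
    map_ofNat]
  simp

theorem W_pow_succ (hW : W = X * (2 + W ^ 3)) (k : ℕ) :
    W ^ (k + 1) = X * (C 2 * W ^ k + W ^ (k + 3)) := by
  rw [map_ofNat]
  linear_combination W ^ k * hW

/-- The coefficients of the powers of `W`, by Lagrange inversion. -/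
theorem coeff_W_pow (hW : W = X * (2 + W ^ 3)) (k n : ℕ) :
    (k + 3 * n : ℚ) * coeff (k + 3 * n) (W ^ k) =
      k * Nat.choose (k + 3 * n) n * 2 ^ (k + 2 * n) := by
  -- Induction on the exponent of t: W^(k+1) = t(2W^k + W^(k+3)) reduces the pair (k+1, n+1) to (k,
  -- n+1) and (k+3, n), both of exponent one less.
  induction hN : k + 3 * n generalizing k n with
  | zero =>
    obtain ⟨rfl, rfl⟩ : k = 0 ∧ n = 0 := by omega
    simp
  | succ N ih =>
    rcases n with _ | n
    · obtain rfl : k = N + 1 := by omega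
      simp [coeff_W_pow_self hW]
    rcases k with _ | k
    · simp [coeff_one]
    rw [W_pow_succ hW, coeff_succ_X_mul, map_add, coeff_C_mul]
    have h1 := ih k (n + 1) (by omega)
    have h2 := ih (k + 3) n (by omega)
    have hb : (N.choose (n + 1) : ℚ) * (n + 1) = N.choose n * (k + 2 * n + 3) := by
      have := Nat.choose_succ_right_eq N n
      rw [show N - n = k + 2 * n + 3 by omega] at this
      exact_mod_cast this
    have hN' : (N : ℚ) = k + 3 * n + 3 := by
      have : N = k + 3 * n + 3 := by omega
      exact_mod_cast this
    have hN0 : (k + 3 * n + 3 : ℚ) * (n + 1) ≠ 0 := by positivity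
    rw [Nat.choose_succ_succ]
    push_cast at h1 h2 ⊢
    apply mul_left_cancel₀ hN0
    generalize coeff N (W ^ k) = a at *
    generalize coeff N (W ^ (k + 3)) = b at *
    generalize (N.choose n : ℚ) = b0 at *
    generalize (N.choose (n + 1) : ℚ) = b1 at *
    rw [show k + 2 * (n + 1) = k + 2 * n + 2 by ring, pow_add] at h1
    rw [show k + 3 + 2 * n = k + 2 * n + 3 by ring, pow_add] at h2
    rw [show k + 1 + 2 * (n + 1) = k + 2 * n + 3 by ring, pow_add]
    linear_combination (n + 1) * (k + 3 * n + 4) * (2 * h1 + h2) +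
      2 ^ (k + 2 * n) * 8 * (k * (k + 3 * n + 4) - (k + 1) * (k + 3 * n + 3)) * hb

theorem X_mul_coeffX_Qx0 (hW : W = X * (2 + W ^ 3)) (i : ℕ) :
    X * coeffX i Qx0 = C (1 / (8 * 4 ^ i)) *
      (C (4 * catalan i : ℚ) * W ^ (2 * i + 1) - C (catalan (i + 1) : ℚ) * W ^ (2 * i + 4)) := by
  have h0 := constantCoeff_eq_zero_of_eq hW
  have hU : constantCoeff (C (1 / 4) * W ^ 2) = 0 := by simp [h0]
  have hU0 : C (1 / 4) * W ^ 2 ≠ 0 := mul_ne_zero (by simp) (pow_ne_zero _ (ne_zero_of_eq hW))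
  have h4 : (4 : PowerSeries (Polynomial ℚ)) = PowerSeries.map Polynomial.C (C 4) := by
    rw [map_ofNat, map_ofNat]
  rw [Qx0_eq_Qx0Closed hW, Qx0Closed, coeffX_map_C_mul, coeffX_sub, h4, coeffX_map_C_mul,
    coeffX_map_C_mul, coeffX_catalanRoot hU, coeffX_catalanRoot_sq hU hU0, mul_pow]
  have hc : C (1 / (8 * 4 ^ i) : ℚ) = C (1 / 8) * C (1 / 4) ^ i := by
    rw [← map_pow, ← map_mul]
    rw [div_pow, one_pow, div_mul_div_comm, one_mul]
  rw [hc, map_mul C (4 : ℚ), pow_succ W (2 * i), pow_add W (2 * i) 4, pow_mul]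
  linear_combination -C (1 / 8 : ℚ) * C (1 / 4) ^ i * (W ^ 2) ^ i *
    (C 4 * C (catalan i : ℚ) - W ^ 3 * C (catalan (i + 1) : ℚ)) * hW

theorem catalan_cast (i : ℕ) : (catalan i : ℚ) = Nat.choose (2 * i) i / (i + 1) := by
  rw [eq_div_iff (by positivity), mul_comm]
  exact_mod_cast succ_mul_catalan_eq_centralBinom i

theorem catalan_succ_cast (i : ℕ) :
    (catalan (i + 1) : ℚ) = 2 * (2 * i + 1) * Nat.choose (2 * i) i / ((i + 1) * (i + 2)) := by
  have h : ((i : ℚ) + 1) * Nat.choose (2 * (i + 1)) (i + 1) =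
      2 * (2 * i + 1) * Nat.choose (2 * i) i := by
    exact_mod_cast Nat.succ_mul_centralBinom_succ i
  rw [catalan_cast, ← h]
  push_cast
  field_simp
  ring

theorem numWalks_formula (hW : W = X * (2 + W ^ 3)) (i n : ℕ) :
    (numWalks i 0 (3 * n + 2 * i) : ℚ) =
      4 ^ n * (2 * (i : ℚ) + 1) / (((n : ℚ) + i + 1) * (2 * n + 2 * i + 1)) *
        (Nat.choose (2 * i) i : ℚ) * (Nat.choose (3 * n + 2 * i) n : ℚ) := by
  have h := congrArg (coeff (3 * n + 2 * i + 1)) (X_mul_coeffX_Qx0 hW i)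
  rw [coeff_succ_X_mul, coeffX, coeff_mk, coeff_Qx0, coeff_C_mul, map_sub, coeff_C_mul,
    coeff_C_mul, catalan_cast, catalan_succ_cast] at h
  rw [h]
  have h4 : (2 : ℚ) ^ (2 * i) = 4 ^ i := by rw [pow_mul]; norm_num
  -- For n = 0 the second power of W starts beyond the degree 2i + 1. Otherwise 2i + 1 + 3(n+1) = 2i
  -- + 4 + 3n, so `coeff_W_pow` applies to both powers.
  rcases n with _ | n
  · rw [coeff_W_pow_of_lt hW (show 3 * 0 + 2 * i + 1 < 2 * i + 4 by omega), show 3 * 0 + 2 * i + 1 = 2 * i + 1 by ring,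
      coeff_W_pow_self hW, pow_succ, h4]
    simp
    field_simp
    ring
  · have hA := coeff_W_pow hW (2 * i + 1) (n + 1)
    have hB := coeff_W_pow hW (2 * i + 4) n
    rw [show 2 * i + 1 + 3 * (n + 1) = 3 * (n + 1) + 2 * i + 1 by ring] at hA
    rw [show 2 * i + 4 + 3 * n = 3 * (n + 1) + 2 * i + 1 by ring] at hB
    have hb1 : ((3 * (n + 1) + 2 * i + 1).choose (n + 1) : ℚ) =
        (3 * n + 2 * i + 4) * (3 * (n + 1) + 2 * i).choose (n + 1) / (2 * n + 2 * i + 3) := by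
      have := Nat.choose_mul_succ_eq (3 * (n + 1) + 2 * i) (n + 1)
      rw [show 3 * (n + 1) + 2 * i + 1 - (n + 1) = 2 * n + 2 * i + 3 by omega,
        show (3 * (n + 1) + 2 * i).choose (n + 1) * (3 * (n + 1) + 2 * i + 1) =
          (3 * n + 2 * i + 4) * (3 * (n + 1) + 2 * i).choose (n + 1) by ring] at this
      rw [eq_div_iff (by positivity)]
      exact_mod_cast this.symm
    have hb0 : ((3 * (n + 1) + 2 * i + 1).choose n : ℚ) =
        (n + 1) * (3 * (n + 1) + 2 * i + 1).choose (n + 1) / (2 * n + 2 * i + 4) := by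
      have := Nat.choose_succ_right_eq (3 * (n + 1) + 2 * i + 1) n
      rw [show 3 * (n + 1) + 2 * i + 1 - n = 2 * n + 2 * i + 4 by omega] at this
      rw [eq_div_iff (by positivity), mul_comm (n + 1 : ℚ)]
      exact_mod_cast this.symm
    rw [hb0, hb1] at hB
    rw [hb1] at hA
    have hM : (3 * n + 2 * i + 4 : ℚ) ≠ 0 := by positivity
    push_cast at hA hB ⊢
    rw [show (2 * i + 1 + 3 * (n + 1) : ℚ) = 3 * n + 2 * i + 4 by ring, mul_comm,
      ← eq_div_iff hM] at hA
    rw [show (2 * i + 4 + 3 * n : ℚ) = 3 * n + 2 * i + 4 by ring, mul_comm,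
      ← eq_div_iff hM] at hB
    have e1 : (2 : ℚ) ^ (2 * i + 1 + 2 * (n + 1)) = 8 * 4 ^ i * 4 ^ n := by
      rw [← h4, show (4 : ℚ) ^ n = 2 ^ (2 * n) by rw [pow_mul]; norm_num]; ring
    have e2 : (2 : ℚ) ^ (2 * i + 4 + 2 * n) = 16 * 4 ^ i * 4 ^ n := by
      rw [← h4, show (4 : ℚ) ^ n = 2 ^ (2 * n) by rw [pow_mul]; norm_num]; ring
    rw [hA, hB, e1, e2, pow_succ (4 : ℚ) n]
    generalize ((3 * (n + 1) + 2 * i).choose (n + 1) : ℚ) = b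
    generalize ((2 * i).choose i : ℚ) = c
    have : (2 * n + 2 * i + 3 : ℚ) ≠ 0 := by positivity
    have : (2 * n + 2 * i + 4 : ℚ) ≠ 0 := by positivity
    have : (n + i + 2 : ℚ) ≠ 0 := by positivity
    rw [show ((n : ℚ) + 1 + i + 1) = n + i + 2 by ring,
      show (2 * ((n : ℚ) + 1) + 2 * i + 1) = 2 * n + 2 * i + 3 by ring,
      show (2 * n + 2 * i + 4 : ℚ) = 2 * (n + i + 2) by ring]
    field_simp
    ring

end Coefficients

end Kreweras

/-! ### The square root and the formulas in Laurent series -/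

namespace Kreweras

open Polynomial

variable {W : PowerSeries ℚ}

/-- The square root of `1 - x W ^ 2`. -/
noncomputable def sqrtOne (W : PowerSeries ℚ) : PowerSeries ℚ[X] :=
  -- This is 1 - 2z c(z) at z = xW²/4.
  1 - PowerSeries.C (C (1 / 2)) * (PowerSeries.C X * PowerSeries.map C W ^ 2 *
    catalanRoot (PowerSeries.C (1 / 4) * W ^ 2))

theorem two_mul_sqrtOne (W : PowerSeries ℚ) :
    2 * sqrtOne W = 2 - PowerSeries.C X * PowerSeries.map C W ^ 2 *
      catalanRoot (PowerSeries.C (1 / 4) * W ^ 2) := by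
  have h2 : (2 : PowerSeries ℚ[X]) * PowerSeries.C (C (1 / 2)) = 1 := by
    rw [← map_ofNat (PowerSeries.C (R := ℚ[X])) 2, ← map_mul, ← map_ofNat (C (R := ℚ)) 2, ← map_mul]
    norm_num
  rw [sqrtOne]
  linear_combination (-PowerSeries.C X * PowerSeries.map C W ^ 2 *
      catalanRoot (PowerSeries.C (1 / 4) * W ^ 2)) * h2

theorem constantCoeff_sqrtOne (hW : PowerSeries.constantCoeff W = 0) :
    PowerSeries.constantCoeff (sqrtOne W) = 1 := by
  have : PowerSeries.constantCoeff (PowerSeries.map (C (R := ℚ)) W) = 0 := by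
    rw [← PowerSeries.coeff_zero_eq_constantCoeff_apply, PowerSeries.coeff_map,
      PowerSeries.coeff_zero_eq_constantCoeff_apply, hW, map_zero]
  simp [sqrtOne, this]

theorem sqrtOne_sq (hW : PowerSeries.constantCoeff W = 0) :
    sqrtOne W ^ 2 = 1 - PowerSeries.C X * PowerSeries.map C W ^ 2 := by
  have := algebraRat.charZero (PowerSeries ℚ[X])
  have h := two_mul_sqrtOne W
  apply mul_left_cancel₀ (show (4 : PowerSeries ℚ[X]) ≠ 0 by norm_num)
  linear_combination (2 * sqrtOne W + (2 - PowerSeries.C X * PowerSeries.map C W ^ 2 *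
      catalanRoot (PowerSeries.C (1 / 4) * W ^ 2))) * h -
    PowerSeries.C X * PowerSeries.map C W ^ 2 * four_mul_catalanRoot hW

theorem toLaurent_C {R : Type} [CommRing R] (K : Type) [Field K] [Algebra R K] (r : R) :
    toLaurent K (PowerSeries.C r) = HahnSeries.C (algebraMap R K r) := by
  simp [toLaurent]

theorem toLaurent_X {R : Type} [CommRing R] (K : Type) [Field K] [Algebra R K] :
    toLaurent K (PowerSeries.X : PowerSeries R) = t K := by
  simp [toLaurent, t]

theorem t_ne_zero (K : Type) [Field K] : t K ≠ 0 := by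
  simp [t]

theorem toLaurent_injective {R : Type} [CommRing R] (K : Type) [Field K] [Algebra R K]
    (h : Function.Injective (algebraMap R K)) :
    Function.Injective (toLaurent K : PowerSeries R →+* LaurentSeries K) := by
  intro F G hFG
  exact PowerSeries.map_injective _ h (HahnSeries.ofPowerSeries_injective (Γ := ℤ) (R := K) hFG)

theorem toLaurent_map_C (F : PowerSeries ℚ) :
    toLaurent (RatFunc ℚ) (PowerSeries.map C F) = toLaurent (RatFunc ℚ) F := by
  simp only [toLaurent, RingHom.comp_apply]
  rw [← RingHom.comp_apply (PowerSeries.map _), ← PowerSeries.map_comp]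
  congr 3
  exact Subsingleton.elim _ _

theorem toLaurent_Qx0 (hW : W = PowerSeries.X * (2 + W ^ 3)) :
    toLaurent (RatFunc ℚ) Qx0 = 1 / (t (RatFunc ℚ) * x) *
      (1 / (2 * t (RatFunc ℚ)) - 1 / x -
        (1 / toLaurent (RatFunc ℚ) W - 1 / x) * toLaurent (RatFunc ℚ) (sqrtOne W)) := by
  have hx : toLaurent (RatFunc ℚ) (PowerSeries.C (X : ℚ[X])) = x := by
    rw [toLaurent_C, RatFunc.algebraMap_X, x]
  have hx0 : x ≠ 0 := by simp [x, RatFunc.X_ne_zero]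
  have ht0 := t_ne_zero (RatFunc ℚ)
  have hW0 : toLaurent (RatFunc ℚ) W ≠ 0 :=
    (map_ne_zero_iff _ (toLaurent_injective _ (algebraMap ℚ _).injective)).2 (ne_zero_of_eq hW)
  have hF := congrArg (toLaurent (RatFunc ℚ)) (X_mul_Qx0Closed hW)
  have hS := congrArg (toLaurent (RatFunc ℚ)) (two_mul_sqrtOne W)
  have hc := congrArg (toLaurent (RatFunc ℚ))
    (four_mul_catalanRoot (constantCoeff_eq_zero_of_eq hW))
  have hw := congrArg (toLaurent (RatFunc ℚ)) hW
  simp only [map_add, map_sub, map_mul, map_pow, map_ofNat, toLaurent_X, hx, toLaurent_map_C]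
    at hF hS hc hw
  rw [← Qx0_eq_Qx0Closed hW] at hF
  generalize toLaurent (RatFunc ℚ) W = w at *
  generalize toLaurent (RatFunc ℚ) (sqrtOne W) = s at *
  generalize toLaurent (RatFunc ℚ) Qx0 = q at *
  generalize toLaurent (RatFunc ℚ) (catalanRoot _) = c at *
  generalize t (RatFunc ℚ) = T at *
  generalize x = x at *
  have := algebraRat.charZero (LaurentSeries (RatFunc ℚ))
  -- The claimed formula multiplied by 2t²x²W.
  have key : 2 * T ^ 2 * x ^ 2 * w * q = x * w - 2 * T * w - 2 * T * (x - w) * s := by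
    linear_combination (T * x ^ 2 * w / 4) * hF + T * (x - w) * hS + T * x * w ^ 3 / 4 * hc - x * hw
  field_simp
  linear_combination key

theorem toLaurent_coeffX_Qx0 (hW : W = PowerSeries.X * (2 + W ^ 3)) (i : ℕ) :
    toLaurent ℚ (coeffX i Qx0) = toLaurent ℚ W ^ (2 * i + 1) / (2 * 4 ^ i * t ℚ) *
      ((catalan i : LaurentSeries ℚ) -
        (catalan (i + 1) : LaurentSeries ℚ) * toLaurent ℚ W ^ 3 / 4) := by
  have h := congrArg (toLaurent ℚ) (X_mul_coeffX_Qx0 hW i)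
  have ht0 := t_ne_zero ℚ
  simp only [map_sub, map_mul, map_pow, toLaurent_X, toLaurent_C, Algebra.algebraMap_self,
    map_div₀, map_one, map_ofNat, map_natCast] at h
  have := algebraRat.charZero (LaurentSeries ℚ)
  apply mul_left_cancel₀ ht0
  rw [h]
  field_simp
  ring

/-- The equation defining `W` has a unique solution. -/
theorem existsUnique_W : ∃! W : PowerSeries ℚ, W = PowerSeries.X * (2 + W ^ 3) := by
  have h (Y : PowerSeries ℚ) : (C 2 + X ^ 3 : Polynomial (PowerSeries ℚ)).eval Y = 2 + Y ^ 3 := by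
    rw [eval_add, eval_C, eval_pow, eval_X]
  obtain ⟨W, hW, hu⟩ := existsUnique_eq_X_mul_eval (C 2 + X ^ 3 : Polynomial (PowerSeries ℚ))
  exact ⟨W, hW.trans (congrArg _ (h W)), fun V hV => hu V (hV.trans (congrArg _ (h V).symm))⟩

end Kreweras

theorem mainTheorem1 :
    -- the equation `W = t (2 + W ^ 3)` defines a power series `W` in `t`
    (∃! W : PowerSeries ℚ, W = PowerSeries.X * (2 + W ^ 3)) ∧
    (∀ W : PowerSeries ℚ, W = PowerSeries.X * (2 + W ^ 3) →
      -- `S = √(1 - x W ^ 2)`, the square root with constant term `1`, exists in `ℚ[x][[t]]`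
      (∃! S : PowerSeries (Polynomial ℚ),
        PowerSeries.constantCoeff S = 1 ∧
        S ^ 2 = 1 - PowerSeries.C Polynomial.X * PowerSeries.map Polynomial.C W ^ 2) ∧
      -- the formula for `Q(x,0;t)`, in the field `ℚ(x)((t))`
      (∀ S : PowerSeries (Polynomial ℚ),
        PowerSeries.constantCoeff S = 1 →
        S ^ 2 = 1 - PowerSeries.C Polynomial.X * PowerSeries.map Polynomial.C W ^ 2 →
        Kreweras.toLaurent (RatFunc ℚ) Kreweras.Qx0 =
          1 / (Kreweras.t (RatFunc ℚ) * Kreweras.x) *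
            (1 / (2 * Kreweras.t (RatFunc ℚ)) - 1 / Kreweras.x -
              (1 / Kreweras.toLaurent (RatFunc ℚ) W - 1 / Kreweras.x) *
                Kreweras.toLaurent (RatFunc ℚ) S)) ∧
      -- the formula for `[x^i] Q(x,0;t)`, in the field `ℚ((t))`
      (∀ i : ℕ,
        Kreweras.toLaurent ℚ (Kreweras.coeffX i Kreweras.Qx0) =
          Kreweras.toLaurent ℚ W ^ (2 * i + 1) / (2 * 4 ^ i * Kreweras.t ℚ) *
            ((catalan i : LaurentSeries ℚ) -
              (catalan (i + 1) : LaurentSeries ℚ) * Kreweras.toLaurent ℚ W ^ 3 / 4))) ∧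
    -- the number of walks of length `3n + 2i` that end at `(i, 0)`
    (∀ i n : ℕ,
      (Kreweras.numWalks i 0 (3 * n + 2 * i) : ℚ) =
        4 ^ n * (2 * (i : ℚ) + 1) / (((n : ℚ) + i + 1) * (2 * n + 2 * i + 1)) *
          (Nat.choose (2 * i) i : ℚ) * (Nat.choose (3 * n + 2 * i) n : ℚ)) := by

  refine ⟨Kreweras.existsUnique_W, fun W hW => ?_, fun i n => ?_⟩
  · have h0 := Kreweras.constantCoeff_eq_zero_of_eq hW
    have huniq : ∀ S : PowerSeries (Polynomial ℚ), PowerSeries.constantCoeff S = 1 →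
        S ^ 2 = 1 - PowerSeries.C Polynomial.X * PowerSeries.map Polynomial.C W ^ 2 →
        S = Kreweras.sqrtOne W := fun S h1 h2 =>
      Kreweras.eq_of_sq_eq_sq_of_constantCoeff h1 (Kreweras.constantCoeff_sqrtOne h0)
        (h2.trans (Kreweras.sqrtOne_sq h0).symm)
    refine ⟨⟨Kreweras.sqrtOne W, ⟨Kreweras.constantCoeff_sqrtOne h0, Kreweras.sqrtOne_sq h0⟩,
      fun S hS => huniq S hS.1 hS.2⟩, fun S h1 h2 => ?_, Kreweras.toLaurent_coeffX_Qx0 hW⟩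
    rw [huniq S h1 h2]
    exact Kreweras.toLaurent_Qx0 hW
  · obtain ⟨W, hW, -⟩ := Kreweras.existsUnique_W
    exact Kreweras.numWalks_formula hW i n
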